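/- Let $d\ge 1$, $\alpha>0$ and $0<\kappa_1,\kappa_2<\infty$. Let $C:\mathbb Z^d\times\mathbb Z^d\to[0,\infty)$ be a symmetric function ($C(x,y)=C(y,x)$) such that $$\frac{\kappa_1}{|y-x|^{1+\alpha}}\le C(x,y)\le\frac{\kappa_2}{|y-x|^{1+\alpha}}\quad\text{if } y-x\in\Big(\bigcup_{i=1}^d\mathbb Z e_i\Big)\setminus\{0\},\qquad C(x,y)=0\ \text{ otherwise},$$ where $|\cdot|$ is the Euclidean norm and $e_1,\dots,e_d$ is the standard basis. Let $Y$ be the continuous-time Markov chain on $\mathbb Z^d$ which waits at each point $x$ for an exponential time of parameter $1$, independent of the past, and then jumps from $x$ to $y$ with probability $C(x,y)/G_x$, where $G_x=\sum_{y\in\mathbb Z^d}C(x,y)$. For $\rho\ge 1$ let $\mathcal S=\rho^{-1}\mathbb Z^d$, let $V_u=\rho^{-1}Y_{\rho^\alpha u}$ for $u\ge 0$, and let $Z$ be the associated space-time process on $[0,\infty)\times\mathcal S$: under $\mathbb P^{(t,x)}$ one has $Z_u=(t+u,V_u)$ with $V_0=x$. For $\gamma\in(0,1)$, $t\ge 0$,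 $x\in\mathcal S$ and $r>0$ put $$Q^\rho(t,x,r)=[t,t+\gamma r^\alpha]\times\big(B(x,r)\cap\mathcal S\big),\qquad \tau_{Q^\rho(t,x,r)}=\inf\{u\ge 0: Z_u\notin Q^\rho(t,x,r)\},$$ where $B(x,r)$ is the open Euclidean ball. Then there is a constant $c_1>0$, depending only on $d,\alpha,\kappa_1,\kappa_2$, such that for every such $C$, all $\rho\ge 1$, $\gamma\in(0,1)$, $r>0$, $s>2r$ and $(t,x)\in[0,\infty)\times\mathcal S$, $$\mathbb P^{(t,x)}\big(Z_{\tau_{Q^\rho(t,x,r)}}\notin Q^\rho(t,x,s)\big)\le c_1\,\frac{r^\alpha}{s^\alpha}.$$ -/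

import Mathlib

open MeasureTheory ProbabilityTheory Set
open scoped NNReal ENNReal

noncomputable section

namespace StableChain

/-- The inclusion of `ℤ^d` into `ℝ^d` (with the Euclidean norm). -/
def toEuclid {d : ℕ} (z : Fin d → ℤ) : EuclideanSpace ℝ (Fin d) :=
  WithLp.toLp 2 (fun i => (z i : ℝ))

/-- The union of the coordinate axes `ℤ e_i` of `ℤ^d`. -/
def axes (d : ℕ) : Set (Fin d → ℤ) :=
  {z | ∃ (i : Fin d) (k : ℤ), z = Pi.single i k}

/-- The singular stable-like conductance functions of index `α` with bounds `κ₁`, `κ₂`. -/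
structure IsConductance {d : ℕ} (α κ₁ κ₂ : ℝ)
    (C : (Fin d → ℤ) → (Fin d → ℤ) → ℝ≥0) : Prop where
  symm : ∀ x y, C x y = C y x
  lower : ∀ x y, y - x ∈ axes d \ {0} →
    κ₁ / ‖toEuclid (y - x)‖ ^ (1 + α) ≤ (C x y : ℝ)
  upper : ∀ x y, y - x ∈ axes d \ {0} →
    (C x y : ℝ) ≤ κ₂ / ‖toEuclid (y - x)‖ ^ (1 + α)
  off_axes : ∀ x y, y - x ∉ axes d \ {0} → C x y = 0

/-- The total conductance `G_x = ∑_y C(x,y)`. -/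
def totalConductance {d : ℕ} (C : (Fin d → ℤ) → (Fin d → ℤ) → ℝ≥0) (x : Fin d → ℤ) : ℝ≥0∞ :=
  ∑' y, (C x y : ℝ≥0∞)

/-- `0 < G_x < ∞` for every `x`, so that the jump probabilities `C(x,y) / G_x` make sense. -/
def Normalizable {d : ℕ} (C : (Fin d → ℤ) → (Fin d → ℤ) → ℝ≥0) : Prop :=
  ∀ x, totalConductance C x ≠ 0 ∧ totalConductance C x ≠ ∞

theorem norm_toEuclid_single {d : ℕ} (i : Fin d) (k : ℤ) :
    ‖toEuclid (Pi.single i k : Fin d → ℤ)‖ = |(k : ℝ)| := by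
  have : toEuclid (Pi.single i k : Fin d → ℤ) = PiLp.single 2 i (k : ℝ) := by
    ext j
    rcases eq_or_ne j i with rfl | h
    · simp [toEuclid]
    · simp [toEuclid, h]
  rw [this]
  simp

/-- A conductance function of the class above is normalizable when `d ≥ 1`, `α > 0`, `κ₁ > 0`. -/
theorem IsConductance.normalizable {d : ℕ} {α κ₁ κ₂ : ℝ}
    {C : (Fin d → ℤ) → (Fin d → ℤ) → ℝ≥0} (hC : IsConductance α κ₁ κ₂ C)
    (hd : 0 < d) (hα : 0 < α) (hκ₁ : 0 < κ₁) : Normalizable C := by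
  intro x
  constructor
  · intro h
    have h0 := ENNReal.tsum_eq_zero.1 h (x + Pi.single ⟨0, hd⟩ 1)
    have h1 : (x + Pi.single ⟨0, hd⟩ 1) - x ∈ axes d \ {0} := by
      refine ⟨⟨⟨0, hd⟩, 1, by simp⟩, ?_⟩
      simp
    have h2 := hC.lower _ _ h1
    rw [add_sub_cancel_left, norm_toEuclid_single] at h2
    have h3 : C x (x + Pi.single ⟨0, hd⟩ 1) = 0 := by exact_mod_cast h0
    rw [h3] at h2
    norm_num at h2
    linarith
  · set g : ℤ → ℝ≥0∞ := fun k => ENNReal.ofReal (κ₂ * |(k : ℝ)| ^ (-(1 + α))) with hg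
    have hle : totalConductance C x ≤
        ∑' y, ∑' p : Fin d × ℤ, (if y = x + Pi.single p.1 p.2 then g p.2 else 0) := by
      refine ENNReal.tsum_le_tsum fun y => ?_
      by_cases hy : y - x ∈ axes d \ {0}
      · obtain ⟨i, k, hk⟩ := hy.1
        have hyk : y = x + Pi.single i k := by rw [← hk]; abel
        refine le_trans ?_ (ENNReal.le_tsum (i, k))
        rw [if_pos hyk]
        have hu := hC.upper _ _ hy
        rw [hk, norm_toEuclid_single, div_eq_mul_inv,
          ← Real.rpow_neg (abs_nonneg _)] at hu
        rw [hg, ← ENNReal.ofReal_coe_nnreal]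
        exact ENNReal.ofReal_le_ofReal hu
      · rw [hC.off_axes _ _ hy]
        simp
    refine ne_top_of_le_ne_top ?_ hle
    rw [ENNReal.tsum_comm]
    simp only [tsum_ite_eq]
    rw [ENNReal.tsum_prod (f := fun (_ : Fin d) (k : ℤ) => g k), tsum_fintype]
    refine ENNReal.sum_ne_top.2 fun i _ => ?_
    have hs : Summable fun k : ℤ => κ₂ * |(k : ℝ)| ^ (-(1 + α)) :=
      (Real.summable_abs_int_rpow (by linarith)).mul_left _
    exact hs.tsum_ofReal_ne_top

/-- The one-step law `y ↦ C(x,y) / G_x` of the discrete time chain started at `x`. -/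
def jumpPMF {d : ℕ} (C : (Fin d → ℤ) → (Fin d → ℤ) → ℝ≥0) (hC : Normalizable C)
    (x : Fin d → ℤ) : PMF (Fin d → ℤ) :=
  PMF.normalize (fun y => (C x y : ℝ≥0∞)) (hC x).1 (hC x).2

/-- The transition kernel of the discrete time chain. -/
def jumpKernel {d : ℕ} (C : (Fin d → ℤ) → (Fin d → ℤ) → ℝ≥0) (hC : Normalizable C) :
    Kernel (Fin d → ℤ) (Fin d → ℤ) :=
  Kernel.ofFunOfCountable fun x => (jumpPMF C hC x).toMeasure

instance {d : ℕ} (C : (Fin d → ℤ) → (Fin d → ℤ) → ℝ≥0) (hC : Normalizable C) :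
    IsMarkovKernel (jumpKernel C hC) :=
  ⟨fun x => PMF.toMeasure.isProbabilityMeasure (jumpPMF C hC x)⟩

/-- The transition from the history up to time `n` to the position at time `n + 1`: it depends on
the present position only. -/
def stepKernel {d : ℕ} (C : (Fin d → ℤ) → (Fin d → ℤ) → ℝ≥0) (hC : Normalizable C) (n : ℕ) :
    Kernel (Finset.Iic n → (Fin d → ℤ)) (Fin d → ℤ) :=
  (jumpKernel C hC).comap (fun h => h ⟨n, Finset.mem_Iic.2 le_rfl⟩) (measurable_pi_apply _)

instance {d : ℕ} (C : (Fin d → ℤ) → (Fin d → ℤ) → ℝ≥0) (hC : Normalizable C) (n : ℕ) :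
    IsMarkovKernel (stepKernel C hC n) := by
  unfold stepKernel; infer_instance

/-- The law of the discrete time chain `(Ỹ_n)_{n ≥ 0}` started at `z`. -/
def skeletonLaw {d : ℕ} (C : (Fin d → ℤ) → (Fin d → ℤ) → ℝ≥0) (hC : Normalizable C)
    (z : Fin d → ℤ) : Measure (ℕ → (Fin d → ℤ)) :=
  Kernel.traj (X := fun _ => Fin d → ℤ) (stepKernel C hC) 0 (fun _ => z)

/-- The sample space: a trajectory of the discrete time chain and a sequence of waiting times. -/
abbrev Path (d : ℕ) : Type := (ℕ → (Fin d → ℤ)) × (ℕ → ℝ)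

/-- The law of the continuous time chain started at `z`: the discrete time chain started at `z`,
and independently of it, i.i.d. exponential waiting times of parameter `1`. -/
def chainLaw {d : ℕ} (C : (Fin d → ℤ) → (Fin d → ℤ) → ℝ≥0) (hC : Normalizable C)
    (z : Fin d → ℤ) : Measure (Path d) :=
  (skeletonLaw C hC z).prod (Measure.infinitePi fun _ : ℕ => expMeasure 1)

/-- The number of jumps made up to time `u`: the first `n` such that the sum of the waiting times
number `0, …, n` exceeds `u` (such an `n` exists almost surely). -/
def jumpCount {d : ℕ} (ω : Path d) (u : ℝ) : ℕ :=
  sInf {n : ℕ | u < ∑ i ∈ Finset.range (n + 1), ω.2 i}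

/-- The continuous time chain `Y`. -/
def Y {d : ℕ} (u : ℝ) (ω : Path d) : Fin d → ℤ := ω.1 (jumpCount ω u)

/-- The rescaled lattice `ρ⁻¹ ℤ^d`, as a subset of `ℝ^d`. -/
def lattice (d : ℕ) (ρ : ℝ) : Set (EuclideanSpace ℝ (Fin d)) :=
  range fun z : Fin d → ℤ => ρ⁻¹ • toEuclid z

/-- The point `ρ x ∈ ℤ^d` for `x ∈ ρ⁻¹ ℤ^d` (it is unique). -/
def scaleUp {d : ℕ} {ρ : ℝ} (x : lattice d ρ) : Fin d → ℤ := x.2.choose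

theorem toEuclid_scaleUp {d : ℕ} {ρ : ℝ} (hρ : ρ ≠ 0) (x : lattice d ρ) :
    toEuclid (scaleUp x) = ρ • (x : EuclideanSpace ℝ (Fin d)) := by
  have h : ρ⁻¹ • toEuclid (scaleUp x) = (x : EuclideanSpace ℝ (Fin d)) := x.2.choose_spec
  rw [← h, smul_inv_smul₀ hρ]

/-- The rescaled process `V_u = ρ⁻¹ Y_{ρ^α u}`. -/
def V {d : ℕ} (α ρ : ℝ) (u : ℝ) (ω : Path d) : lattice d ρ :=
  ⟨ρ⁻¹ • toEuclid (Y (ρ ^ α * u) ω), ⟨_, rfl⟩⟩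

/-- The law `ℙ^x` under which `V_0 = x`, that is, `Y_0 = ρ x`. -/
def rescaledLaw {d : ℕ} (C : (Fin d → ℤ) → (Fin d → ℤ) → ℝ≥0) (hC : Normalizable C)
    {ρ : ℝ} (x : lattice d ρ) : Measure (Path d) :=
  chainLaw C hC (scaleUp x)

/-- The space-time process `Z_u = (t + u, V_u)` started at time `t`. Its first coordinate is
deterministic, so `ℙ^{(t,x)}` is the law of this process under `ℙ^x`. -/
def Z {d : ℕ} (α ρ t : ℝ) (u : ℝ) (ω : Path d) : ℝ × lattice d ρ := (t + u, V α ρ u ω)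

/-- The cylinder `Q^ρ_γ(t,x,r) = [t, t + γ r^α] × (B(x,r) ∩ ρ⁻¹ ℤ^d)`. -/
def cylinder {d : ℕ} {ρ : ℝ} (α γ t : ℝ) (x : lattice d ρ) (r : ℝ) : Set (ℝ × lattice d ρ) :=
  Icc t (t + γ * r ^ α) ×ˢ Metric.ball x r

/-- The first exit time of a path `w` from the set `A`. -/
def exitTime {E : Type*} (w : ℝ → E) (A : Set E) : ℝ := sInf {u : ℝ | 0 ≤ u ∧ w u ∉ A}

end StableChain

end

noncomputable section

namespace StableChain

theorem rpow_neg_one_sub_le_telescope {α : ℝ} (hα : 0 < α) {k : ℕ} (hk : 0 < k) :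
    (k : ℝ) ^ (-(1 + α)) ≤
      2 ^ (1 + α) / α * ((k : ℝ) ^ (-α) - ((k + 1 : ℕ) : ℝ) ^ (-α)) := by
  have hk' : (1 : ℝ) ≤ k := by exact_mod_cast hk
  have hk0 : (0 : ℝ) < k := by linarith
  obtain ⟨c, hc, hc'⟩ := exists_hasDerivAt_eq_slope (fun x : ℝ => x ^ (-α))
    (fun x => -α * x ^ (-α - 1)) (show (k : ℝ) < k + 1 by linarith)
    (fun x hx => (Real.continuousAt_rpow_const _ _
      (Or.inl (hk0.trans_le hx.1).ne')).continuousWithinAt)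
    (fun x hx => Real.hasDerivAt_rpow_const (Or.inl (hk0.trans hx.1).ne'))
  rw [add_sub_cancel_left, div_one] at hc'
  have hc0 : 0 < c := hk0.trans hc.1
  have h1 : (2 * k : ℝ) ^ (-α - 1) ≤ c ^ (-α - 1) :=
    Real.rpow_le_rpow_of_nonpos hc0 (by linarith [hc.2]) (by linarith)
  have h2 : (2 * k : ℝ) ^ (-α - 1) = (2 ^ (1 + α))⁻¹ * (k : ℝ) ^ (-(1 + α)) := by
    rw [Real.mul_rpow two_pos.le hk0.le, ← Real.rpow_neg two_pos.le]
    congr 2 <;> ring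
  rw [h2, inv_mul_le_iff₀ (by positivity)] at h1
  push_cast
  rw [show (k : ℝ) ^ (-α) - ((k : ℝ) + 1) ^ (-α) = α * c ^ (-α - 1) by linarith,
    ← mul_assoc, div_mul_cancel₀ _ hα.ne']
  exact h1

theorem tsum_rpow_tail_le {α : ℝ} (hα : 0 < α) {m : ℕ} (hm : 0 < m) :
    ∑' n : ℕ, ENNReal.ofReal (((m + n : ℕ) : ℝ) ^ (-(1 + α))) ≤
      ENNReal.ofReal (2 ^ (1 + α) / α * (m : ℝ) ^ (-α)) := by
  have hc : 0 ≤ 2 ^ (1 + α) / α := by positivity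
  refine ENNReal.tsum_le_of_sum_range_le fun N => ?_
  rw [← ENNReal.ofReal_sum_of_nonneg (fun i _ => by positivity)]
  refine ENNReal.ofReal_le_ofReal ?_
  calc ∑ n ∈ Finset.range N, ((m + n : ℕ) : ℝ) ^ (-(1 + α))
      ≤ ∑ n ∈ Finset.range N, 2 ^ (1 + α) / α *
          (((m + n : ℕ) : ℝ) ^ (-α) - ((m + (n + 1) : ℕ) : ℝ) ^ (-α)) :=
        Finset.sum_le_sum fun n _ => rpow_neg_one_sub_le_telescope hα (by omega)
    _ = 2 ^ (1 + α) / α * ((m : ℝ) ^ (-α) - ((m + N : ℕ) : ℝ) ^ (-α)) := by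
        rw [← Finset.mul_sum, Finset.sum_range_sub' (fun n : ℕ => ((m + n : ℕ) : ℝ) ^ (-α))]
        simp
    _ ≤ _ := by
        gcongr
        have : 0 ≤ ((m + N : ℕ) : ℝ) ^ (-α) := by positivity
        linarith

theorem tsum_abs_int_rpow_tail_le {α : ℝ} (hα : 0 < α) {L : ℝ} (hL : 0 < L) :
    ∑' k : ℤ, (if L ≤ |(k : ℝ)| then ENNReal.ofReal (|(k : ℝ)| ^ (-(1 + α))) else 0) ≤
      2 * ENNReal.ofReal (2 ^ (1 + α) / α * L ^ (-α)) := by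
  set f : ℕ → ℝ≥0∞ := fun n =>
    if L ≤ (n : ℝ) then ENNReal.ofReal ((n : ℝ) ^ (-(1 + α))) else 0 with hf
  have hm : 0 < ⌈L⌉₊ := Nat.ceil_pos.2 hL
  have hN : ∑' n : ℕ, f n ≤ ENNReal.ofReal (2 ^ (1 + α) / α * L ^ (-α)) := by
    have hz : ∑ n ∈ Finset.range ⌈L⌉₊, f n = 0 := by
      refine Finset.sum_eq_zero fun n hn => ?_
      rw [hf]
      refine if_neg (not_le.2 (Nat.lt_ceil.1 (Finset.mem_range.1 hn)))
    rw [← Summable.sum_add_tsum_nat_add' (f := f) (k := ⌈L⌉₊) ENNReal.summable, hz, zero_add]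
    calc ∑' n, f (n + ⌈L⌉₊)
        ≤ ∑' n : ℕ, ENNReal.ofReal (((⌈L⌉₊ + n : ℕ) : ℝ) ^ (-(1 + α))) := by
          refine ENNReal.tsum_le_tsum fun n => ?_
          rw [hf, add_comm n]
          dsimp only
          split_ifs <;> simp
      _ ≤ _ := tsum_rpow_tail_le hα hm
      _ ≤ _ := by
          refine ENNReal.ofReal_le_ofReal ?_
          gcongr ?_ * ?_
          exact Real.rpow_le_rpow_of_nonpos hL (Nat.le_ceil L) (by linarith)
  have hle : ∀ k : ℤ, (if L ≤ |(k : ℝ)| then ENNReal.ofReal (|(k : ℝ)| ^ (-(1 + α))) else 0) =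
      f k.natAbs := by
    intro k
    have : |(k : ℝ)| = (k.natAbs : ℝ) := by
      rw [Nat.cast_natAbs, Int.cast_abs]
    rw [this]
  simp_rw [hle]
  rw [tsum_of_nat_of_neg_add_one (f := fun k : ℤ => f k.natAbs) ENNReal.summable
    ENNReal.summable, two_mul]
  refine add_le_add (by simpa using hN) (le_trans ?_ hN)
  calc ∑' n : ℕ, f (-((n : ℤ) + 1)).natAbs = ∑' n : ℕ, f (n + 1) := rfl
    _ ≤ ∑' n, f n := ENNReal.tsum_comp_le_tsum_of_injective (add_left_injective 1) f

/-- The probability of a jump of length at least `L`. -/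
theorem jumpKernel_far_le {d : ℕ} (hd : 0 < d) {α κ₁ κ₂ : ℝ} (hα : 0 < α) (hκ₁ : 0 < κ₁)
    (hκ₂ : 0 < κ₂) {C : (Fin d → ℤ) → (Fin d → ℤ) → ℝ≥0} (hC : IsConductance α κ₁ κ₂ C)
    (x : Fin d → ℤ) {L : ℝ} (hL : 0 < L) :
    jumpKernel C (hC.normalizable hd hα hκ₁) x {y | L ≤ ‖toEuclid (y - x)‖} ≤
      ENNReal.ofReal (κ₁⁻¹ * d * κ₂ * 2 * (2 ^ (1 + α) / α) * L ^ (-α)) := by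
  have hG : ENNReal.ofReal κ₁ ≤ totalConductance C x := by
    have h1 : (x + Pi.single ⟨0, hd⟩ 1) - x ∈ axes d \ {0} := by
      refine ⟨⟨⟨0, hd⟩, 1, by simp⟩, ?_⟩
      simp
    have h2 := hC.lower _ _ h1
    rw [add_sub_cancel_left, norm_toEuclid_single] at h2
    refine le_trans ?_ (ENNReal.le_tsum (x + Pi.single ⟨0, hd⟩ 1))
    rw [← ENNReal.ofReal_coe_nnreal]
    exact ENNReal.ofReal_le_ofReal (by simpa using h2)
  set g : ℤ → ℝ≥0∞ := fun k =>
    if L ≤ |(k : ℝ)| then ENNReal.ofReal (|(k : ℝ)| ^ (-(1 + α))) else 0 with hg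
  have hS : ∑' y, {y | L ≤ ‖toEuclid (y - x)‖}.indicator (fun y => (C x y : ℝ≥0∞)) y ≤
      d * (ENNReal.ofReal κ₂ * (2 * ENNReal.ofReal (2 ^ (1 + α) / α * L ^ (-α)))) := by
    calc ∑' y, {y | L ≤ ‖toEuclid (y - x)‖}.indicator (fun y => (C x y : ℝ≥0∞)) y
        ≤ ∑' y, ∑' p : Fin d × ℤ,
            (if y = x + Pi.single p.1 p.2 then ENNReal.ofReal κ₂ * g p.2 else 0) := by
          refine ENNReal.tsum_le_tsum fun y => ?_
          by_cases hyL : L ≤ ‖toEuclid (y - x)‖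
          · rw [indicator_of_mem (by exact hyL)]
            by_cases hy : y - x ∈ axes d \ {0}
            · obtain ⟨i, k, hk⟩ := hy.1
              have hyk : y = x + Pi.single i k := by rw [← hk]; abel
              refine le_trans ?_ (ENNReal.le_tsum (i, k))
              have hu := hC.upper _ _ hy
              rw [hk, norm_toEuclid_single] at hyL hu
              rw [div_eq_mul_inv, ← Real.rpow_neg (abs_nonneg _)] at hu
              rw [if_pos hyk, hg]
              dsimp only
              rw [if_pos hyL, ← ENNReal.ofReal_coe_nnreal, ← ENNReal.ofReal_mul hκ₂.le]
              exact ENNReal.ofReal_le_ofReal hu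
            · rw [hC.off_axes _ _ hy]
              simp
          · rw [indicator_of_notMem (by exact hyL)]
            exact zero_le
      _ = d * (ENNReal.ofReal κ₂ * ∑' k, g k) := by
          rw [ENNReal.tsum_comm]
          simp only [tsum_ite_eq]
          rw [ENNReal.tsum_prod (f := fun (_ : Fin d) (k : ℤ) => ENNReal.ofReal κ₂ * g k),
            tsum_fintype]
          simp [ENNReal.tsum_mul_left]
      _ ≤ _ := by
          gcongr
          exact tsum_abs_int_rpow_tail_le hα hL
  have hval : jumpKernel C (hC.normalizable hd hα hκ₁) x {y | L ≤ ‖toEuclid (y - x)‖} =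
      (∑' y, {y | L ≤ ‖toEuclid (y - x)‖}.indicator (fun y => (C x y : ℝ≥0∞)) y) *
        (totalConductance C x)⁻¹ := by
    change (jumpPMF C (hC.normalizable hd hα hκ₁) x).toMeasure _ = _
    rw [PMF.toMeasure_apply _ (MeasurableSet.of_discrete),
      ← ENNReal.tsum_mul_right]
    congr 1
    ext y
    have h : jumpPMF C (hC.normalizable hd hα hκ₁) x y = C x y * (totalConductance C x)⁻¹ :=
      PMF.normalize_apply _ _ y
    by_cases hy : y ∈ {y | L ≤ ‖toEuclid (y - x)‖}
    · rw [indicator_of_mem hy, indicator_of_mem hy, h]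
    · rw [indicator_of_notMem hy, indicator_of_notMem hy, zero_mul]
  rw [hval]
  calc _ ≤ d * (ENNReal.ofReal κ₂ * (2 * ENNReal.ofReal (2 ^ (1 + α) / α * L ^ (-α)))) *
        (ENNReal.ofReal κ₁)⁻¹ := by gcongr
    _ = _ := by
        rw [← ENNReal.ofReal_inv_of_pos hκ₁, ← ENNReal.ofReal_natCast d,
          show (2 : ℝ≥0∞) = ENNReal.ofReal 2 by simp,
          ← ENNReal.ofReal_mul (by positivity), ← ENNReal.ofReal_mul (by positivity),
          ← ENNReal.ofReal_mul (by positivity), ← ENNReal.ofReal_mul (by positivity)]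
        congr 1
        ring

instance {d : ℕ} (C : (Fin d → ℤ) → (Fin d → ℤ) → ℝ≥0) (hC : Normalizable C) (z : Fin d → ℤ) :
    IsProbabilityMeasure (skeletonLaw C hC z) := by
  unfold skeletonLaw; infer_instance

/-- A uniform bound on the transition probabilities bounds the law of a single step. -/
theorem skeletonLaw_step_le {d : ℕ} (C : (Fin d → ℤ) → (Fin d → ℤ) → ℝ≥0) (hC : Normalizable C)
    (z : Fin d → ℤ) (n : ℕ) (S : Set ((Fin d → ℤ) × (Fin d → ℤ))) {b : ℝ≥0∞}
    (hb : ∀ x, jumpKernel C hC x {y | (x, y) ∈ S} ≤ b) :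
    skeletonLaw C hC z {w | (w n, w (n + 1)) ∈ S} ≤ b := by
  set i : Finset.Iic n := ⟨n, Finset.mem_Iic.2 le_rfl⟩
  set A : Set ((Finset.Iic n → Fin d → ℤ) × (Fin d → ℤ)) := {p | (p.1 i, p.2) ∈ S} with hA
  have hAm : MeasurableSet A := by
    have : Measurable fun p : (Finset.Iic n → Fin d → ℤ) × (Fin d → ℤ) => (p.1 i, p.2) := by
      fun_prop
    exact this (MeasurableSet.of_discrete (s := S))
  have hmap := Kernel.partialTraj_compProd_eq_map_traj (X := fun _ => Fin d → ℤ)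
    (κ := stepKernel C hC) (Nat.zero_le n) (x₀ := fun _ => z)
  have h1 : skeletonLaw C hC z {w | (w n, w (n + 1)) ∈ S} =
      ((Kernel.traj (X := fun _ => Fin d → ℤ) (stepKernel C hC) 0 (fun _ => z)).map
        (fun x => (Preorder.frestrictLe n x, x (n + 1)))) A := by
    rw [Measure.map_apply (by fun_prop) hAm]
    rfl
  rw [h1, ← hmap, Measure.compProd_apply hAm]
  refine (lintegral_mono (g := fun _ => b) fun h => ?_).trans (by simp)
  rw [stepKernel, Kernel.comap_apply]
  exact hb (h i)

theorem skeletonLaw_zero {d : ℕ} (C : (Fin d → ℤ) → (Fin d → ℤ) → ℝ≥0) (hC : Normalizable C)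
    (z : Fin d → ℤ) : ∀ᵐ w ∂skeletonLaw C hC z, w 0 = z := by
  have hmap := Kernel.traj_map_frestrictLe_apply (X := fun _ => Fin d → ℤ)
    (κ := stepKernel C hC) 0 0 (fun _ => z)
  rw [Kernel.partialTraj_self, Kernel.id_apply] at hmap
  have h : ∀ᵐ h ∂((skeletonLaw C hC z).map (Preorder.frestrictLe 0)),
      h ⟨0, Finset.mem_Iic.2 le_rfl⟩ = z := by
    rw [skeletonLaw, hmap]
    refine (ae_dirac_iff ?_).2 rfl
    exact (measurable_pi_apply (X := fun _ : Finset.Iic 0 => Fin d → ℤ) _)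
      (measurableSet_singleton z)
  exact ae_of_ae_map (by fun_prop) h

instance : IsProbabilityMeasure (expMeasure 1) := isProbabilityMeasure_expMeasure one_pos

theorem ae_pos_expMeasure : ∀ᵐ x ∂expMeasure 1, 0 < x := by
  have h : cdf (expMeasure 1) 0 = 0 := by
    rw [cdf_expMeasure_eq one_pos]; simp
  rw [cdf_eq_real, measureReal_eq_zero_iff] at h
  rw [ae_iff]
  simpa [Iic] using h

theorem lintegral_exp_neg_mul_expMeasure {l : ℝ} (hl : 0 < l) :
    ∫⁻ x, ENNReal.ofReal (Real.exp (-l * x)) ∂expMeasure 1 = ENNReal.ofReal (1 + l)⁻¹ := by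
  have h : ∀ x : ℝ, exponentialPDF 1 x * ENNReal.ofReal (Real.exp (-l * x)) =
      ENNReal.ofReal (1 + l)⁻¹ * exponentialPDF (1 + l) x := by
    intro x
    rcases lt_or_ge x 0 with hx | hx
    · simp [exponentialPDF_of_neg hx]
    · rw [exponentialPDF_of_nonneg hx, exponentialPDF_of_nonneg hx,
        ← ENNReal.ofReal_mul (by positivity), ← ENNReal.ofReal_mul (by positivity), one_mul,
        ← Real.exp_add, ← mul_assoc, inv_mul_cancel₀ (by positivity), one_mul]
      congr 2
      ring_nf
  have hm : Measurable (exponentialPDF 1) := (measurable_exponentialPDFReal 1).ennreal_ofReal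
  calc ∫⁻ x, ENNReal.ofReal (Real.exp (-l * x)) ∂expMeasure 1
      = ∫⁻ x, exponentialPDF 1 x * ENNReal.ofReal (Real.exp (-l * x)) :=
        lintegral_withDensity_eq_lintegral_mul _ hm (by fun_prop)
    _ = ENNReal.ofReal (1 + l)⁻¹ := by
        simp_rw [h]
        rw [lintegral_const_mul (f := exponentialPDF (1 + l)) _
          (measurable_exponentialPDFReal _).ennreal_ofReal,
          lintegral_exponentialPDF_eq_one (by positivity), mul_one]

theorem integrable_exp_neg_mul_expMeasure {l : ℝ} (hl : 0 < l) :
    Integrable (fun x => Real.exp (-l * x)) (expMeasure 1) := by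
  refine ⟨by fun_prop, ?_⟩
  rw [hasFiniteIntegral_iff_ofReal (ae_of_all _ fun x => (Real.exp_pos _).le),
    lintegral_exp_neg_mul_expMeasure hl]
  exact ENNReal.ofReal_lt_top

theorem integral_exp_neg_mul_expMeasure {l : ℝ} (hl : 0 < l) :
    ∫ x, Real.exp (-l * x) ∂expMeasure 1 = (1 + l)⁻¹ := by
  rw [integral_eq_lintegral_of_nonneg_ae (ae_of_all _ fun x => (Real.exp_pos _).le)
    (by fun_prop), lintegral_exp_neg_mul_expMeasure hl, ENNReal.toReal_ofReal (by positivity)]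

/-- Chernoff's bound for the sum of `n` independent exponential waiting times. -/
theorem waiting_sum_le {t : ℝ} (ht : 0 < t) (n : ℕ) :
    (Measure.infinitePi fun _ : ℕ => expMeasure 1)
        {w | ∑ i ∈ Finset.range n, w i ≤ t} ≤
      ENNReal.ofReal (Real.exp 1 * ((1 + t⁻¹)⁻¹) ^ n) := by
  set μ := Measure.infinitePi fun _ : ℕ => expMeasure 1 with hμ
  have hind : iIndepFun (fun (i : ℕ) (w : ℕ → ℝ) => w i) μ :=
    iIndepFun_infinitePi (X := fun _ x => x) (fun _ => measurable_id)
  have hmap : ∀ i : ℕ, μ.map (fun w => w i) = expMeasure 1 := fun i =>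
    Measure.infinitePi_map_eval _ i
  have hmeas : ∀ i : ℕ, Measurable fun w : ℕ → ℝ => w i := fun i => measurable_pi_apply i
  have hint : ∀ i : ℕ, Integrable (fun w : ℕ → ℝ => Real.exp (-t⁻¹ * w i)) μ := by
    intro i
    have := integrable_exp_neg_mul_expMeasure (inv_pos.2 ht)
    rw [← hmap i] at this
    exact this.comp_measurable (hmeas i)
  have hmgf : ∀ i : ℕ, mgf (fun w : ℕ → ℝ => w i) μ (-t⁻¹) = (1 + t⁻¹)⁻¹ := by
    intro i
    rw [← integral_exp_neg_mul_expMeasure (inv_pos.2 ht), ← hmap i,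
      integral_map (hmeas i).aemeasurable (by fun_prop)]
    rfl
  have hch := measure_le_le_exp_mul_mgf (μ := μ) (t := -t⁻¹) t (by simpa using ht.le)
    (hind.integrable_exp_mul_sum hmeas (s := Finset.range n) fun i _ => hint i)
  rw [hind.mgf_sum hmeas, Finset.prod_congr rfl fun i _ => hmgf i, Finset.prod_const,
    Finset.card_range, neg_neg, inv_mul_cancel₀ ht.ne'] at hch
  rw [← ofReal_measureReal]
  refine ENNReal.ofReal_le_ofReal (le_trans (le_of_eq ?_) hch)
  simp only [Finset.sum_apply]

theorem tsum_waiting_sum_le {t : ℝ} (ht : 0 < t) :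
    ∑' n : ℕ, (Measure.infinitePi fun _ : ℕ => expMeasure 1)
        {w | ∑ i ∈ Finset.range (n + 1), w i ≤ t} ≤ ENNReal.ofReal (Real.exp 1 * t) := by
  have hq : (1 + t⁻¹)⁻¹ < 1 := inv_lt_one_of_one_lt₀ (by have := inv_pos.2 ht; linarith)
  have hq0 : 0 < (1 + t⁻¹)⁻¹ := by positivity
  have hs : HasSum (fun n : ℕ => Real.exp 1 * ((1 + t⁻¹)⁻¹) ^ (n + 1)) (Real.exp 1 * t) := by
    have h1 : (1 + t⁻¹)⁻¹ * (1 - (1 + t⁻¹)⁻¹)⁻¹ = t := by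
      have h2 : (1 + t⁻¹)⁻¹ = t / (t + 1) := by field_simp
      have h3 : 1 - t / (t + 1) = 1 / (t + 1) := by field_simp; ring
      rw [h2, h3]
      field_simp
    have h := ((hasSum_geometric_of_lt_one hq0.le hq).mul_left (1 + t⁻¹)⁻¹).mul_left (Real.exp 1)
    rw [h1] at h
    simpa only [pow_succ'] using h
  refine (ENNReal.tsum_le_tsum fun n => waiting_sum_le ht (n + 1)).trans ?_
  rw [← ENNReal.ofReal_tsum_of_nonneg (fun n => by positivity) hs.summable, hs.tsum_eq]

/-- If the waiting times are positive, a path which leaves the cylinder by jumping far away makes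
a long jump at a time at most `ρ^α r^α`. -/
theorem exists_long_jump {d : ℕ} {α ρ γ r s t : ℝ} (hα : 0 < α) (hρ : 1 ≤ ρ) (hγ : 0 < γ)
    (hγ1 : γ < 1) (hr : 0 < r) (hs : 2 * r < s) (x : lattice d ρ) (ω : Path d)
    (h0 : ω.1 0 = scaleUp x) (hpos : ∀ i, 0 < ω.2 i)
    (hω : Z α ρ t (exitTime (fun u => Z α ρ t u ω) (cylinder α γ t x r)) ω ∉ cylinder α γ t x s) :
    ∃ n : ℕ, ρ * s / 2 ≤ ‖toEuclid (ω.1 (n + 1) - ω.1 n)‖ ∧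
      ∑ i ∈ Finset.range (n + 1), ω.2 i ≤ (ρ * r) ^ α := by
  have hρ0 : 0 < ρ := by linarith
  have hρα : 0 < ρ ^ α := Real.rpow_pos_of_pos hρ0 _
  have hrα : 0 < r ^ α := Real.rpow_pos_of_pos hr _
  set E : Set ℝ := {u : ℝ | 0 ≤ u ∧ Z α ρ t u ω ∉ cylinder α γ t x r} with hE
  set τ := exitTime (fun u => Z α ρ t u ω) (cylinder α γ t x r) with hτ
  have hτE : τ = sInf E := rfl
  have hbdd : BddBelow E := ⟨0, fun u hu => hu.1⟩
  have hτ0 : 0 ≤ τ := Real.sInf_nonneg fun u hu => hu.1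
  have hτle : τ ≤ γ * r ^ α := by
    refine le_of_forall_gt_imp_ge_of_dense fun u hu => csInf_le hbdd ⟨?_, fun h => ?_⟩
    · exact (mul_pos hγ hrα).le.trans hu.le
    · have := h.1.2
      simp only [Z] at this
      linarith
  have hbefore : ∀ u, 0 ≤ u → u < τ → dist (V α ρ u ω) x < r := by
    intro u hu hut
    by_contra hcon
    exact notMem_of_lt_csInf (hτE ▸ hut) hbdd ⟨hu, fun h => hcon h.2⟩
  have hVs : s ≤ dist (V α ρ τ ω) x := by
    by_contra hcon
    refine hω ⟨⟨by simp only [Z]; linarith, ?_⟩, not_le.1 hcon⟩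
    have : r ^ α ≤ s ^ α := Real.rpow_le_rpow hr.le (by linarith) hα.le
    have : γ * r ^ α ≤ γ * s ^ α := by gcongr
    simp only [Z]
    linarith
  have hdist : ∀ u, dist (V α ρ u ω) x = ρ⁻¹ * ‖toEuclid (Y (ρ ^ α * u) ω) - toEuclid (scaleUp x)‖ := by
    intro u
    have h : (V α ρ u ω : EuclideanSpace ℝ (Fin d)) - x =
        ρ⁻¹ • (toEuclid (Y (ρ ^ α * u) ω) - ρ • (x : EuclideanSpace ℝ (Fin d))) := by
      rw [smul_sub, inv_smul_smul₀ hρ0.ne']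
      rfl
    rw [Subtype.dist_eq, dist_eq_norm, toEuclid_scaleUp hρ0.ne', h, norm_smul, norm_inv,
      Real.norm_of_nonneg hρ0.le]
  rw [hdist] at hVs
  set T : ℕ → ℝ := fun n => ∑ i ∈ Finset.range n, ω.2 i with hT
  have hTmono : StrictMono T := strictMono_nat_of_lt_succ fun n => by
    rw [hT]; simp only [Finset.sum_range_succ]; linarith [hpos n]
  rcases hN : jumpCount ω (ρ ^ α * τ) with _ | n
  · rw [Y, hN, h0] at hVs
    simp at hVs
    linarith
  have hTn : T (n + 1) ≤ ρ ^ α * τ := by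
    have : n ∉ {n : ℕ | ρ ^ α * τ < ∑ i ∈ Finset.range (n + 1), ω.2 i} :=
      Nat.notMem_of_lt_sInf (by rw [jumpCount] at hN; omega)
    exact not_lt.1 this
  have hTn0 : 0 ≤ T n := Finset.sum_nonneg fun i _ => (hpos i).le
  have hcount : jumpCount ω (T n) = n := by
    refine le_antisymm (Nat.sInf_le (hTmono n.lt_succ_self)) ?_
    refine le_csInf ⟨n, hTmono n.lt_succ_self⟩ fun m hm => ?_
    have := hTmono.lt_iff_lt.1 (show T n < T (m + 1) from hm)
    omega
  have hVr := hbefore (T n / ρ ^ α) (by positivity) (by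
    rw [div_lt_iff₀' hρα]
    exact (hTmono n.lt_succ_self).trans_le hTn)
  rw [hdist, mul_div_cancel₀ _ hρα.ne', Y, hcount] at hVr
  rw [Y, hN] at hVs
  refine ⟨n, ?_, ?_⟩
  · rw [inv_mul_lt_iff₀ hρ0] at hVr
    rw [le_inv_mul_iff₀ hρ0] at hVs
    have htri := norm_sub_le_norm_sub_add_norm_sub (toEuclid (ω.1 (n + 1))) (toEuclid (ω.1 n))
      (toEuclid (scaleUp x))
    have hsub : toEuclid (ω.1 (n + 1) - ω.1 n) = toEuclid (ω.1 (n + 1)) - toEuclid (ω.1 n) := by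
      ext j; simp [toEuclid]
    rw [hsub]
    nlinarith
  · calc T (n + 1) ≤ ρ ^ α * τ := hTn
      _ ≤ ρ ^ α * (1 * r ^ α) := by gcongr; exact hτle.trans (by gcongr)
      _ = (ρ * r) ^ α := by rw [one_mul, Real.mul_rpow hρ0.le hr.le]

end StableChain

end

theorem mainTheorem7 (d : ℕ) (hd : 0 < d) (α κ₁ κ₂ : ℝ) (hα : 0 < α) (hκ₁ : 0 < κ₁)
    (hκ₂ : 0 < κ₂) :
    ∃ c₁ : ℝ, 0 < c₁ ∧
      ∀ (C : (Fin d → ℤ) → (Fin d → ℤ) → ℝ≥0) (hC : StableChain.IsConductance α κ₁ κ₂ C)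
        (ρ : ℝ) (_ : 1 ≤ ρ) (γ : ℝ) (_ : 0 < γ) (_ : γ < 1)
        (r s : ℝ) (_ : 0 < r) (_ : 2 * r < s)
        (t : ℝ) (_ : 0 ≤ t) (x : StableChain.lattice d ρ),
        (StableChain.rescaledLaw C (hC.normalizable hd hα hκ₁) x)
            {ω | StableChain.Z α ρ t
                (StableChain.exitTime (fun u => StableChain.Z α ρ t u ω)
                  (StableChain.cylinder α γ t x r)) ω
              ∉ StableChain.cylinder α γ t x s}
          ≤ ENNReal.ofReal (c₁ * (r ^ α / s ^ α)) := by
  set K : ℝ := κ₁⁻¹ * d * κ₂ * 2 * (2 ^ (1 + α) / α) with hK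
  have hd' : (0 : ℝ) < d := by exact_mod_cast hd
  have hK0 : 0 < K := by positivity
  refine ⟨K * 2 ^ α * Real.exp 1, by positivity, ?_⟩
  intro C hC ρ hρ γ hγ hγ1 r s hr hs t _ x
  have hρ0 : 0 < ρ := by linarith
  have hs0 : 0 < s := by linarith
  set μ := StableChain.skeletonLaw C (hC.normalizable hd hα hκ₁) (StableChain.scaleUp x) with hμ
  set ν := Measure.infinitePi fun _ : ℕ => expMeasure 1 with hν
  set A : ℕ → Set (ℕ → Fin d → ℤ) := fun n =>
    {w | ρ * s / 2 ≤ ‖StableChain.toEuclid (w (n + 1) - w n)‖} with hA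
  set B : ℕ → Set (ℕ → ℝ) := fun n =>
    {w | ∑ i ∈ Finset.range (n + 1), w i ≤ (ρ * r) ^ α} with hB
  have hfst : ∀ᵐ ω ∂μ.prod ν, ω.1 0 = StableChain.scaleUp x :=
    Measure.quasiMeasurePreserving_fst.ae (StableChain.skeletonLaw_zero _ _ _)
  have hsnd : ∀ᵐ ω ∂μ.prod ν, ∀ i, 0 < ω.2 i := by
    refine Measure.quasiMeasurePreserving_snd.ae (p := fun w : ℕ → ℝ => ∀ i, 0 < w i) ?_
    refine ae_all_iff.2 fun i => ?_
    refine ae_of_ae_map (f := fun w : ℕ → ℝ => w i)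
      (measurable_pi_apply i).aemeasurable ?_
    rw [hν, Measure.infinitePi_map_eval]
    exact StableChain.ae_pos_expMeasure
  have hAle : ∀ n, μ (A n) ≤ ENNReal.ofReal (K * (ρ * s / 2) ^ (-α)) := fun n =>
    StableChain.skeletonLaw_step_le C _ _ n
      {p | ρ * s / 2 ≤ ‖StableChain.toEuclid (p.2 - p.1)‖}
      (fun y => StableChain.jumpKernel_far_le hd hα hκ₁ hκ₂ hC y (by positivity))
  calc _ ≤ (μ.prod ν) (⋃ n, A n ×ˢ B n) := by
        refine measure_mono_ae ?_
        filter_upwards [hfst, hsnd] with ω h0 hpos hω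
        obtain ⟨n, h1, h2⟩ := StableChain.exists_long_jump hα hρ hγ hγ1 hr hs x ω h0 hpos hω
        exact mem_iUnion.2 ⟨n, h1, h2⟩
    _ ≤ ∑' n, (μ.prod ν) (A n ×ˢ B n) := measure_iUnion_le _
    _ = ∑' n, μ (A n) * ν (B n) := by simp_rw [Measure.prod_prod]
    _ ≤ ∑' n, ENNReal.ofReal (K * (ρ * s / 2) ^ (-α)) * ν (B n) := by
        gcongr with n
        exact hAle n
    _ ≤ ENNReal.ofReal (K * (ρ * s / 2) ^ (-α)) *
          ENNReal.ofReal (Real.exp 1 * (ρ * r) ^ α) := by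
        rw [ENNReal.tsum_mul_left]
        gcongr
        exact StableChain.tsum_waiting_sum_le (by positivity)
    _ = _ := by
        rw [← ENNReal.ofReal_mul (by positivity)]
        congr 1
        rw [Real.rpow_neg (by positivity), Real.div_rpow (by positivity) two_pos.le,
          Real.mul_rpow hρ0.le hs0.le, Real.mul_rpow hρ0.le hr.le]
        have := Real.rpow_pos_of_pos hρ0 α
        have := Real.rpow_pos_of_pos hs0 α
        field_simp
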